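/- Let $\mathbb{S}^2\subset\mathbb{R}^3$ be the unit sphere with its surface area measure $\operatorname{vol}$, polar angle $\theta\in[0,\pi]$ and azimuthal angle $\varphi$. Let $P_n(t)=\frac{1}{2^n n!}\frac{d^n}{dt^n}(t^2-1)^n$ be the Legendre polynomials and $P_n^m(t)=(-1)^m(1-t^2)^{m/2}\frac{d^m}{dt^m}P_n(t)$ the associated Legendre functions. Let $\mathcal{B}$ be the set of functions on $\mathbb{S}^2$ consisting of $P_n(\cos\theta)$ for $n\ge 0$ and of $P_n^m(\cos\theta)\cos(m\varphi)$ and $P_n^m(\cos\theta)\sin(m\varphi)$ for $1\le m\le n$; these are eigenfunctions of the Laplace--Beltrami operator, $-\Delta_{\mathbb{S}^2}\psi=n(n+1)\psi$. Let $(\psi_k)_{k\ge 0}$ be any sequence of functions in $\mathcal{B}$ such that $\psi_k$ is an eigenfunction of $-\Delta_{\mathbb{S}^2}$ with eigenvalue $n_k(n_k+1)$, where the $n_k$ are non-negative integers with $n_k\to\infty$. Then $$\lim_{k\to\infty}\frac{\operatorname{vol}\{x\in\mathbb{S}^2:\psi_k(x)>0\}}{\operatorname{vol}\{x\in\mathbb{S}^2:\psi_k(x)<0\}}=1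 .$$ -/

import Mathlib

open MeasureTheory Filter Topology

namespace SphericalHarmonics

/-- Euclidean three-space. -/
abbrev E3 : Type := EuclideanSpace ℝ (Fin 3)

/-- The unit sphere `𝕊²` of Euclidean three-space. -/
abbrev S2 : Type := Metric.sphere (0 : E3) 1

/-- The surface area measure on `𝕊²` (total mass `4π`). -/
noncomputable def area : Measure S2 := (volume : Measure E3).toSphere

/-- The polar angle `θ ∈ [0, π]` of a point of the sphere, so that `cos θ` is its third coordinate. -/
noncomputable def polar (x : S2) : ℝ := Real.arccos ((x : E3) 2)

/-- The azimuthal angle `φ ∈ (-π, π]` of a point of the sphere (with the value `0` at the two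
poles, where the angle is irrelevant). -/
noncomputable def azimuth (x : S2) : ℝ := Complex.arg ⟨(x : E3) 0, (x : E3) 1⟩

/-- The Legendre polynomial `P_n(t) = (1 / (2^n n!)) (d/dt)^n (t^2 - 1)^n`. -/
noncomputable def legendre (n : ℕ) : Polynomial ℝ :=
  Polynomial.C (1 / (2 ^ n * (n.factorial : ℝ))) *
    Polynomial.derivative^[n] ((Polynomial.X ^ 2 - 1) ^ n)

/-- The associated Legendre function
`P_n^m(t) = (-1)^m (1 - t^2)^(m/2) (d/dt)^m P_n(t)`, for `t ∈ [-1, 1]`. -/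
noncomputable def assocLegendre (n m : ℕ) (t : ℝ) : ℝ :=
  (-1) ^ m * Real.sqrt (1 - t ^ 2) ^ m * (Polynomial.derivative^[m] (legendre n)).eval t

/-- The zonal function `P_n(cos θ)`. -/
noncomputable def zonal (n : ℕ) (x : S2) : ℝ := (legendre n).eval (Real.cos (polar x))

/-- The function `P_n^m(cos θ) cos(m φ)`. -/
noncomputable def cosHarmonic (n m : ℕ) (x : S2) : ℝ :=
  assocLegendre n m (Real.cos (polar x)) * Real.cos (m * azimuth x)

/-- The function `P_n^m(cos θ) sin(m φ)`. -/
noncomputable def sinHarmonic (n m : ℕ) (x : S2) : ℝ :=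
  assocLegendre n m (Real.cos (polar x)) * Real.sin (m * azimuth x)

/-- The set `𝓑` of functions on the sphere: the zonal functions `P_n(cos θ)`, `n ≥ 0`, and the
functions `P_n^m(cos θ) cos(m φ)` and `P_n^m(cos θ) sin(m φ)` with `1 ≤ m ≤ n`. -/
def basis : Set (S2 → ℝ) :=
  {ψ | (∃ n : ℕ, ψ = zonal n) ∨
    ∃ n m : ℕ, 1 ≤ m ∧ m ≤ n ∧ (ψ = cosHarmonic n m ∨ ψ = sinHarmonic n m)}

/-- The extension of a function on the sphere to a function on `E3` that is constant along the
open rays from the origin (with the value `0` at the origin). -/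
noncomputable def radialExtension (f : S2 → ℝ) (y : E3) : ℝ :=
  open Classical in
  if h : y = 0 then 0
  else f ⟨‖y‖⁻¹ • y, by simp [norm_smul, h]⟩

/-- The Laplace-Beltrami operator of the round sphere: the restriction to the sphere of the
Euclidean Laplacian of the extension that is constant along rays. -/
noncomputable def laplaceBeltrami (f : S2 → ℝ) (x : S2) : ℝ :=
  Laplacian.laplacian (radialExtension f) (x : E3)

/-- `f` is a smooth eigenfunction of (minus) the Laplace-Beltrami operator with eigenvalue `μ`:
`f` is nonzero and `-Δ f = μ f`. -/
def IsEigenfunction (f : S2 → ℝ) (μ : ℝ) : Prop :=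
  ContDiffOn ℝ (⊤ : ℕ∞) (radialExtension f) {0}ᶜ ∧ f ≠ 0 ∧
    ∀ x : S2, -laplaceBeltrami f x = μ * f x

end SphericalHarmonics

namespace SphericalHarmonics

/-! If `m ≥ 1`, the rotation by `π / m` about the axis multiplies `cos (m φ)` and `sin (m φ)` by
`-1`, so the two sign sets are congruent and the ratio is exactly 1
(`area_ratio_eq_one_of_comp_sphereMap_eq_neg`). Only zonal functions need asymptotics.

For these, `u = √(sin θ) P_n(cos θ)` satisfies `u'' + (ω² + 1 / (4 sin² θ)) u = 0` with `ω = n +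
1/2`. Away from the poles the perturbation is bounded, so `u` is `r cos (ω θ - α)` up to a relative
error `O(1/ω)` (`exists_amplitude_phase`); neither `r` nor `α` has to be known. A shift by the half
period `π / ω` exchanges the signs of the cosine and hardly changes the density `sin θ` of the area,
so each sign carries about half of the mass (`exists_le_integral_sin_mul_indicator`).

An eigenfunction determines its eigenvalue, hence each fixed zonal function occurs only finitely
often in the sequence, and the eigenvalues of zonal functions never have to be computed. -/

/-! ### The Legendre differential equation. -/

open Polynomial in
theorem derivative_X_sq_sub_one_pow (n : ℕ) :
    ((X : ℝ[X]) ^ 2 - 1) * derivative ((X ^ 2 - 1) ^ n) =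
      C (2 * (n : ℝ)) * X * (X ^ 2 - 1) ^ n := by
  cases n with
  | zero => simp
  | succ n =>
    simp only [derivative_pow, derivative_sub, derivative_X, derivative_one, Nat.add_sub_cancel,
      map_mul, map_ofNat, map_natCast]
    push_cast
    ring

-- Each identity is the derivative of the preceding one, starting from the first-order equation of
-- `(X ^ 2 - 1) ^ n`. At `k = n` the coefficients become `2` and `-n (n + 1)`, which is Legendre's
-- equation up to sign.
open Polynomial in
theorem iterate_derivative_X_sq_sub_one_pow_recurrence (n k : ℕ) :
    ((X : ℝ[X]) ^ 2 - 1) * derivative^[k + 2] ((X ^ 2 - 1) ^ n) +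
      C (2 * ((k : ℝ) + 1) - 2 * n) * X * derivative^[k + 1] ((X ^ 2 - 1) ^ n) +
      C (((k : ℝ) + 1) * k - 2 * n * (k + 1)) * derivative^[k] ((X ^ 2 - 1) ^ n) = 0 := by
  induction k with
  | zero =>
    have h := congrArg derivative (derivative_X_sq_sub_one_pow n)
    simp only [derivative_mul, derivative_C, derivative_X, derivative_sub, derivative_X_pow,
      derivative_one, zero_mul, zero_add, mul_one, Nat.cast_ofNat] at h
    simp only [Function.iterate_succ', Function.iterate_zero, Function.comp_apply, id]
    simp only [map_sub, map_mul, map_add, map_one, map_ofNat, Nat.cast_zero, map_zero] at h ⊢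
    linear_combination h
  | succ k ih =>
    have h := congrArg derivative ih
    simp only [derivative_add, derivative_mul, derivative_C, derivative_X, derivative_sub,
      derivative_X_pow, derivative_one, zero_mul, zero_add, mul_one, map_zero, Nat.cast_ofNat,
      ← Function.iterate_succ_apply' derivative] at h
    simp only [map_sub, map_mul, map_add, map_one, map_ofNat, Nat.cast_succ] at h ⊢
    simp only [show k + 1 + 2 = (k + 2).succ from rfl, show k + 1 + 1 = k + 2 from rfl,
      show (k + 1).succ = k + 2 from rfl, show k.succ = k + 1 from rfl] at h ⊢
    linear_combination h

open Polynomial in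
theorem legendre_ode (n : ℕ) :
    (1 - (X : ℝ[X]) ^ 2) * derivative (derivative (legendre n)) -
      2 * X * derivative (legendre n) + C ((n : ℝ) * (n + 1)) * legendre n = 0 := by
  have h := iterate_derivative_X_sq_sub_one_pow_recurrence n n
  simp only [legendre, derivative_mul, derivative_C, zero_mul, zero_add]
  simp only [Function.iterate_succ', Function.comp_apply] at h
  simp only [map_sub, map_mul, map_add, map_one, map_ofNat, map_natCast] at h ⊢
  linear_combination (-C (1 / (2 ^ n * (n.factorial : ℝ)))) * h

open Polynomial in
theorem legendre_ne_zero (n : ℕ) : legendre n ≠ 0 := by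
  have hdeg : ((X : ℝ[X]) ^ 2 - 1).natDegree = 2 := by compute_degree!
  have hmon : ((X : ℝ[X]) ^ 2 - 1).Monic := by monicity!
  have hc : (((X : ℝ[X]) ^ 2 - 1) ^ n).coeff (n + n) = 1 := by
    have := (hmon.pow n).coeff_natDegree
    rwa [hmon.natDegree_pow, hdeg, show n * 2 = n + n by ring] at this
  intro h
  have h2 := congrArg (fun p => p.coeff n) h
  simp only [legendre, coeff_C_mul, coeff_iterate_derivative, hc, coeff_zero] at h2
  have h3 : (n + n).descFactorial n ≠ 0 := by
    simp [Nat.descFactorial_eq_zero_iff_lt]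
  have : (n.factorial : ℝ) ≠ 0 := by positivity
  simp_all

/-! ### Liouville normal form and the oscillation of Legendre polynomials. -/

/-- The polynomial `P` multiplied by the square root which removes the first order term of the
Legendre equation in the polar angle. -/
noncomputable def liouville (P : Polynomial ℝ) (θ : ℝ) : ℝ :=
  √(Real.sin θ) * P.eval (Real.cos θ)

/-- The derivative of `liouville P`. -/
noncomputable def liouvilleDeriv (P : Polynomial ℝ) (θ : ℝ) : ℝ :=
  Real.cos θ / (2 * √(Real.sin θ)) * P.eval (Real.cos θ) -
    √(Real.sin θ) * Real.sin θ * P.derivative.eval (Real.cos θ)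

theorem hasDerivAt_liouville (P : Polynomial ℝ) {θ : ℝ} (h : 0 < Real.sin θ) :
    HasDerivAt (liouville P) (liouvilleDeriv P θ) θ := by
  have h1 := (Real.hasDerivAt_sin θ).sqrt h.ne'
  have h2 := (P.hasDerivAt (Real.cos θ)).comp θ (Real.hasDerivAt_cos θ)
  convert! h1.mul h2 using 1
  simp only [liouvilleDeriv, Function.comp_apply]
  ring

theorem hasDerivAt_liouvilleDeriv (n : ℕ) {θ : ℝ} (h : 0 < Real.sin θ) :
    HasDerivAt (liouvilleDeriv (legendre n))
      (-(((n : ℝ) + 1 / 2) ^ 2 + 1 / (4 * Real.sin θ ^ 2)) * liouville (legendre n) θ) θ := by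
  have h1 := (Real.hasDerivAt_sin θ).sqrt h.ne'
  have h2 := ((legendre n).hasDerivAt (Real.cos θ)).comp θ (Real.hasDerivAt_cos θ)
  have h3 := ((legendre n).derivative.hasDerivAt (Real.cos θ)).comp θ (Real.hasDerivAt_cos θ)
  have hs : 0 < √(Real.sin θ) := Real.sqrt_pos.2 h
  have h4 := ((Real.hasDerivAt_cos θ).div (h1.const_mul 2) (by positivity)).mul h2
  have h5 := (h1.mul (Real.hasDerivAt_sin θ)).mul h3
  have ode := congrArg (Polynomial.eval (Real.cos θ)) (legendre_ode n)
  convert! h4.sub h5 using 1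
  simp only [Polynomial.eval_add, Polynomial.eval_sub, Polynomial.eval_mul, Polynomial.eval_pow,
    Polynomial.eval_X, Polynomial.eval_one, Polynomial.eval_C, Polynomial.eval_zero,
    Polynomial.eval_ofNat] at ode
  simp only [liouville, Function.comp_apply, Pi.div_apply, Pi.mul_apply]
  have hsq : √(Real.sin θ) ^ 2 = Real.sin θ := Real.sq_sqrt h.le
  have hcs := Real.sin_sq_add_cos_sq θ
  set s := √(Real.sin θ)
  set c := Real.cos θ
  set p := (legendre n).eval c
  set p1 := (Polynomial.derivative (legendre n)).eval c
  set p2 := (Polynomial.derivative (Polynomial.derivative (legendre n))).eval c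
  rw [← hsq] at hcs ⊢
  -- In terms of `s = √(sin θ)` the claim is rational in `s` and `c`; this relation and the Legendre
  -- equation are all it needs.
  have e : s ^ 4 = 1 - c ^ 2 := by linear_combination hcs
  field_simp
  rw [← e] at ode
  linear_combination (-16 * s ^ 4) * ode + 4 * p * e

/-- A solution `u` of `u'' + (ω² + q) u = 0` on `[a, b]` with `|q| ≤ C` is close to a pure
oscillation of frequency `ω`, relative to its amplitude. -/
theorem exists_amplitude_phase {u v q : ℝ → ℝ} {a b ω C : ℝ} (hab : a ≤ b) (hω : 0 < ω)
    (hu : ∀ θ ∈ Set.Icc a b, HasDerivAt u (v θ) θ)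
    (hv : ∀ θ ∈ Set.Icc a b, HasDerivAt v (-(ω ^ 2 + q θ) * u θ) θ)
    (hq : ∀ θ ∈ Set.Icc a b, |q θ| ≤ C) :
    ∃ r α : ℝ, 0 ≤ r ∧ ∀ θ ∈ Set.Icc a b, |u θ - r * Real.cos (ω * θ - α)| ≤
      r * (C / ω * Real.exp (C / ω * (b - a)) * (b - a)) := by
  have hC : 0 ≤ C := (abs_nonneg _).trans (hq a ⟨le_rfl, hab⟩)
  set K := C / ω with hK
  have hK0 : 0 ≤ K := by positivity
  -- Variation of constants: `w` would be constant if `q` were zero, and in general its derivative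
  -- contains only the term with `q / ω`.
  let w : ℝ → ℂ := fun θ => Complex.exp (Complex.I * (ω * θ : ℝ)) *
    ((u θ : ℂ) + Complex.I * ((v θ / ω : ℝ) : ℂ))
  let w' : ℝ → ℂ := fun θ =>
    -Complex.I * ((q θ / ω * u θ : ℝ) : ℂ) * Complex.exp (Complex.I * (ω * θ : ℝ))
  have hw : ∀ θ ∈ Set.Icc a b, HasDerivAt w (w' θ) θ := by
    intro θ hθ
    have h1 : HasDerivAt (fun θ : ℝ => Complex.I * ((ω * θ : ℝ) : ℂ)) (Complex.I * (ω : ℝ)) θ := by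
      have := ((hasDerivAt_id θ).const_mul ω).ofReal_comp.const_mul Complex.I
      simpa using this
    have h2 := h1.cexp.mul ((hu θ hθ).ofReal_comp.add
      (((hv θ hθ).div_const ω).ofReal_comp.const_mul Complex.I))
    convert! h2 using 1
    have hω' : (ω : ℂ) ≠ 0 := by exact_mod_cast hω.ne'
    simp only [w', Pi.add_apply]
    push_cast
    field_simp
    linear_combination (-(ω : ℂ) * v θ) * Complex.I_sq
  have hwn : ∀ θ, |u θ| ≤ ‖w θ‖ := by
    intro θ
    simp only [w, norm_mul, mul_comm Complex.I ((ω * θ : ℝ) : ℂ), Complex.norm_exp_ofReal_mul_I,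
      one_mul]
    have := Complex.abs_re_le_norm ((u θ : ℂ) + Complex.I * ((v θ / ω : ℝ) : ℂ))
    simpa using this
  have hw' : ∀ θ ∈ Set.Icc a b, ‖w' θ‖ ≤ K * ‖w θ‖ := by
    intro θ hθ
    have : ‖w' θ‖ = |q θ| / ω * |u θ| := by
      simp only [w', norm_mul, mul_comm Complex.I ((ω * θ : ℝ) : ℂ),
        Complex.norm_exp_ofReal_mul_I, norm_neg, Complex.norm_I, Complex.norm_real,
        Real.norm_eq_abs, abs_div, abs_of_pos hω]
      ring
    rw [this, hK]
    gcongr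
    · exact hq θ hθ
    · exact hwn θ
  -- Grönwall bounds `w` by its initial value; fed back into the bound for `w'`, this shows that `w`
  -- hardly moves.
  have hgron : ∀ θ ∈ Set.Icc a b, ‖w θ‖ ≤ ‖w a‖ * Real.exp (K * (b - a)) := by
    intro θ hθ
    have := norm_le_gronwallBound_of_norm_deriv_right_le (f := w) (f' := w') (δ := ‖w a‖) (K := K)
      (ε := 0) (a := a) (b := b) (fun x hx => (hw x hx).continuousAt.continuousWithinAt)
      (fun x hx => (hw x ⟨hx.1, hx.2.le⟩).hasDerivWithinAt) le_rfl
      (fun x hx => by simpa using hw' x ⟨hx.1, hx.2.le⟩) θ hθ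
    rw [gronwallBound_ε0] at this
    refine this.trans ?_
    gcongr
    exact hθ.2
  have hdiff : ∀ θ ∈ Set.Icc a b, ‖w θ - w a‖ ≤
      ‖w a‖ * (K * Real.exp (K * (b - a)) * (b - a)) := by
    intro θ hθ
    have := norm_image_sub_le_of_norm_deriv_le_segment' (f := w) (f' := w')
      (C := K * (‖w a‖ * Real.exp (K * (b - a)))) (a := a) (b := b)
      (fun x hx => (hw x hx).hasDerivWithinAt)
      (fun x hx => (hw' x ⟨hx.1, hx.2.le⟩).trans
        (mul_le_mul_of_nonneg_left (hgron x ⟨hx.1, hx.2.le⟩) hK0)) θ hθ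
    refine this.trans ?_
    have h3 : θ - a ≤ b - a := by linarith [hθ.2]
    calc _ ≤ K * (‖w a‖ * Real.exp (K * (b - a))) * (b - a) := by gcongr
      _ = _ := by ring
  -- Since `u θ` is the real part of `exp (-i ω θ) * w θ`, freezing `w` at `a` gives the pure
  -- oscillation.
  refine ⟨‖w a‖, Complex.arg (w a), norm_nonneg _, fun θ hθ => ?_⟩
  refine le_trans ?_ (hdiff θ hθ)
  have hre : u θ - ‖w a‖ * Real.cos (ω * θ - Complex.arg (w a)) =
      (Complex.exp ((-(ω * θ) : ℝ) * Complex.I) * (w θ - w a)).re := by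
    have e1 : Complex.exp ((-(ω * θ) : ℝ) * Complex.I) * w θ =
        (u θ : ℂ) + Complex.I * ((v θ / ω : ℝ) : ℂ) := by
      simp only [w]
      rw [← mul_assoc, ← Complex.exp_add]
      have : ((-(ω * θ) : ℝ) * Complex.I + Complex.I * ((ω * θ : ℝ) : ℂ)) = 0 := by
        push_cast; ring
      rw [this]; simp
    have e2 : Complex.exp ((-(ω * θ) : ℝ) * Complex.I) * w a =
        ‖w a‖ * Complex.exp ((Complex.arg (w a) - ω * θ : ℝ) * Complex.I) := by
      nth_rewrite 1 [← Complex.norm_mul_exp_arg_mul_I (w a)]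
      rw [mul_left_comm, ← Complex.exp_add]
      congr 2
      push_cast; ring
    rw [mul_sub, e1, e2, Complex.sub_re, Complex.re_ofReal_mul, Complex.exp_ofReal_mul_I_re,
      ← Real.cos_neg (ω * θ - _)]
    simp
  rw [hre]
  refine (Complex.abs_re_le_norm _).trans ?_
  rw [norm_mul, Complex.norm_exp_ofReal_mul_I, one_mul]

theorem sin_le_sin_of_mem_Icc {ε θ : ℝ} (h0 : 0 < ε) (hθ : θ ∈ Set.Icc ε (Real.pi - ε)) :
    Real.sin ε ≤ Real.sin θ := by
  have hπ := Real.pi_pos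
  rcases le_total θ (Real.pi / 2) with h | h
  · exact Real.sin_le_sin_of_le_of_le_pi_div_two (by linarith) h hθ.1
  · rw [← Real.sin_pi_sub θ]
    exact Real.sin_le_sin_of_le_of_le_pi_div_two (by linarith) (by linarith) (by linarith [hθ.2])

/-- Away from the poles the sign of the Legendre polynomial of high degree is that of a cosine
of frequency `n + 1 / 2`, except where this cosine is small. -/
theorem eventually_sign_legendre {ε δ : ℝ} (hε : 0 < ε) (hε' : ε < Real.pi / 2) (hδ : 0 < δ) :
    ∀ᶠ n : ℕ in atTop, ∃ α : ℝ, ∀ θ ∈ Set.Icc ε (Real.pi - ε),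
      (δ < Real.cos (((n : ℝ) + 1 / 2) * θ - α) → 0 < (legendre n).eval (Real.cos θ)) ∧
      (Real.cos (((n : ℝ) + 1 / 2) * θ - α) < -δ → (legendre n).eval (Real.cos θ) < 0) := by
  have hsε : 0 < Real.sin ε := Real.sin_pos_of_pos_of_lt_pi hε (by linarith)
  set C := 1 / (4 * Real.sin ε ^ 2) with hC
  set b := Real.pi - ε with hb
  have hlim : Tendsto (fun n : ℕ => C / ((n : ℝ) + 1 / 2) *
      Real.exp (C / ((n : ℝ) + 1 / 2) * (b - ε)) * (b - ε)) atTop (𝓝 0) := by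
    have h1 : Tendsto (fun n : ℕ => C / ((n : ℝ) + 1 / 2)) atTop (𝓝 0) :=
      tendsto_const_nhds.div_atTop (tendsto_atTop_add_const_right _ _ tendsto_natCast_atTop_atTop)
    have h2 := (h1.mul ((Real.continuous_exp.tendsto _).comp (h1.mul_const (b - ε)))).mul_const
      (b - ε)
    simpa using h2
  filter_upwards [hlim.eventually (gt_mem_nhds hδ)] with n hn
  have hsin : ∀ θ ∈ Set.Icc ε b, 0 < Real.sin θ := fun θ hθ =>
    hsε.trans_le (sin_le_sin_of_mem_Icc hε hθ)
  obtain ⟨r, α, hr, h⟩ := exists_amplitude_phase (u := liouville (legendre n))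
    (v := liouvilleDeriv (legendre n)) (q := fun θ => 1 / (4 * Real.sin θ ^ 2)) (a := ε) (b := b)
    (ω := (n : ℝ) + 1 / 2) (C := C) (by linarith) (by positivity)
    (fun θ hθ => hasDerivAt_liouville _ (hsin θ hθ))
    (fun θ hθ => hasDerivAt_liouvilleDeriv n (hsin θ hθ))
    (fun θ hθ => by
      have := hsin θ hθ
      rw [abs_of_nonneg (by positivity), hC]
      gcongr
      exact sin_le_sin_of_mem_Icc hε hθ)
  -- Zero amplitude would make `P_n` vanish on a whole interval.
  have hr0 : 0 < r := by
    refine hr.lt_of_ne fun h0 => legendre_ne_zero n ?_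
    refine Polynomial.eq_zero_of_infinite_isRoot _
      (((Set.Icc_infinite (show ε < b by linarith)).image (f := Real.cos) ?_).mono ?_)
    · exact Real.injOn_cos.mono (Set.Icc_subset_Icc hε.le (by linarith))
    · rintro _ ⟨θ, hθ, rfl⟩
      have h1 := h θ hθ
      rw [← h0, zero_mul, zero_mul, sub_zero] at h1
      have h2 := abs_nonpos_iff.1 h1
      exact (mul_eq_zero.1 h2).resolve_left (Real.sqrt_pos.2 (hsin θ hθ)).ne'
  refine ⟨α, fun θ hθ => ?_⟩
  have hs := Real.sqrt_pos.2 (hsin θ hθ)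
  have h1 := abs_le.1 ((h θ hθ).trans (mul_le_mul_of_nonneg_left hn.le hr))
  simp only [liouville] at h1
  refine ⟨fun h2 => ?_, fun h2 => ?_⟩
  · have := mul_lt_mul_of_pos_left h2 hr0
    exact pos_of_mul_pos_right (by linarith : 0 < √(Real.sin θ) * _) hs.le
  · have := mul_lt_mul_of_pos_left h2 hr0
    have h3 : √(Real.sin θ) * (legendre n).eval (Real.cos θ) < 0 := by linarith
    exact (pos_iff_neg_of_mul_neg h3).1 hs

/-! ### Signs of a fast cosine against the weight `sin θ`. -/

theorem intervalIntegrable_of_abs_le_one {g : ℝ → ℝ} (hg : Measurable g) (hb : ∀ x, |g x| ≤ 1)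
    (a b : ℝ) : IntervalIntegrable g volume a b :=
  (intervalIntegrable_const (c := (1 : ℝ))).mono_fun hg.aestronglyMeasurable
    (Eventually.of_forall fun x => by simpa using hb x)

/-- The sine is almost invariant under small shifts in the weak sense. -/
theorem abs_integral_sin_mul_shift_sub_le {g : ℝ → ℝ} (hg : Measurable g) (hb : ∀ x, |g x| ≤ 1)
    {a b h : ℝ} (hab : a ≤ b) (hh : 0 ≤ h) :
    |(∫ θ in a..b, Real.sin θ * g (θ + h)) - ∫ θ in a..b, Real.sin θ * g θ| ≤
      (b - a + 2) * h := by
  have hb1 : ∀ s x, |Real.sin (x - s) * g x| ≤ 1 := fun s x => by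
    rw [abs_mul]
    exact mul_le_one₀ (Real.abs_sin_le_one _) (abs_nonneg _) (hb x)
  have hint : ∀ s c d, IntervalIntegrable (fun x => Real.sin (x - s) * g x) volume c d :=
    fun s c d => intervalIntegrable_of_abs_le_one (by fun_prop) (hb1 s) c d
  -- Moving the shift onto the sine leaves two end pieces of length `h`, each at most `h`, and an
  -- interior error of at most `(b - a) * h`.
  have e1 : (∫ θ in a..b, Real.sin θ * g (θ + h)) =
      ∫ θ in (a + h)..(b + h), Real.sin (θ - h) * g θ := by
    rw [← intervalIntegral.integral_comp_add_right (fun θ => Real.sin (θ - h) * g θ)]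
    simp
  have e2 : (∫ θ in (a + h)..(b + h), Real.sin (θ - h) * g θ) =
      (∫ θ in a..b, Real.sin (θ - h) * g θ) + (∫ θ in b..(b + h), Real.sin (θ - h) * g θ) -
        ∫ θ in a..(a + h), Real.sin (θ - h) * g θ := by
    rw [intervalIntegral.integral_add_adjacent_intervals (hint h _ _) (hint h _ _),
      eq_sub_iff_add_eq, add_comm,
      intervalIntegral.integral_add_adjacent_intervals (hint h _ _) (hint h _ _)]
  have e3 : (∫ θ in a..b, Real.sin (θ - h) * g θ) - (∫ θ in a..b, Real.sin θ * g θ) =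
      ∫ θ in a..b, (Real.sin (θ - h) - Real.sin θ) * g θ := by
    rw [← intervalIntegral.integral_sub (hint h _ _) (by simpa using hint 0 a b)]
    simp [sub_mul]
  have b1 : ∀ c, |∫ θ in c..(c + h), Real.sin (θ - h) * g θ| ≤ h := fun c => by
    have := intervalIntegral.norm_integral_le_of_norm_le_const (a := c) (b := c + h) (C := 1)
      (f := fun θ => Real.sin (θ - h) * g θ) (fun x _ => hb1 h x)
    simpa [abs_of_nonneg hh] using this
  have b2 : |∫ θ in a..b, (Real.sin (θ - h) - Real.sin θ) * g θ| ≤ (b - a) * h := by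
    have := intervalIntegral.norm_integral_le_of_norm_le_const (a := a) (b := b) (C := h)
      (f := fun θ => (Real.sin (θ - h) - Real.sin θ) * g θ) (fun x _ => by
        rw [norm_mul]
        have h1 : ‖Real.sin (x - h) - Real.sin x‖ ≤ h := by
          have := Real.abs_sin_sub_sin_le (x - h) x
          rwa [show x - h - x = -h by ring, abs_neg, abs_of_nonneg hh] at this
        calc _ ≤ h * 1 := mul_le_mul h1 (hb x) (abs_nonneg _) hh
          _ = h := mul_one h)
    rw [abs_of_nonneg (sub_nonneg.2 hab), mul_comm] at this
    exact this
  rw [e1, e2]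
  have b3 := b1 b
  have b4 := b1 a
  rw [← e3] at b2
  rw [abs_le] at *
  constructor <;> linarith [b2.1, b2.2, b3.1, b3.2, b4.1, b4.2]

/-- Dominated convergence: the indicators tend to zero except at the single zero `π / 2` of the
cosine. -/
theorem exists_integral_indicator_abs_cos_le_lt {η : ℝ} (hη : 0 < η) :
    ∃ δ : ℝ, 0 < δ ∧
      ∫ y in (0 : ℝ)..Real.pi, {y : ℝ | |Real.cos y| ≤ δ}.indicator (fun _ => (1 : ℝ)) y < η := by
  have hlim : Tendsto (fun k : ℕ => ∫ y in (0 : ℝ)..Real.pi,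
      {y : ℝ | |Real.cos y| ≤ 1 / ((k : ℝ) + 1)}.indicator (fun _ => (1 : ℝ)) y) atTop
      (𝓝 (∫ y in (0 : ℝ)..Real.pi, (0 : ℝ))) := by
    refine intervalIntegral.tendsto_integral_filter_of_dominated_convergence (fun _ => 1)
      (Eventually.of_forall fun k => ?_) (Eventually.of_forall fun k => Eventually.of_forall
        fun x _ => ?_) intervalIntegrable_const ?_
    · exact (measurable_const.indicator
        (measurableSet_le (by fun_prop) measurable_const)).aestronglyMeasurable
    · refine (norm_indicator_le_norm_self _ _).trans ?_
      simp
    · have hne : ∀ᵐ x : ℝ, x ≠ Real.pi / 2 := by simp [ae_iff]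
      filter_upwards [hne] with x hx hx'
      rw [Set.uIoc_of_le Real.pi_pos.le] at hx'
      have hc : 0 < |Real.cos x| := by
        refine abs_pos.2 fun h => hx (Real.injOn_cos ⟨hx'.1.le, hx'.2⟩ ?_ ?_)
        · constructor <;> linarith [Real.pi_pos]
        · rw [h, Real.cos_pi_div_two]
      refine tendsto_const_nhds.congr' ?_
      filter_upwards [tendsto_one_div_add_atTop_nhds_zero_nat.eventually (gt_mem_nhds hc)]
        with k hk
      rw [Set.indicator_of_notMem]
      simpa using hk
  rw [intervalIntegral.integral_zero] at hlim
  obtain ⟨k, hk⟩ := (hlim.eventually (gt_mem_nhds hη)).exists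
  exact ⟨1 / ((k : ℝ) + 1), by positivity, hk⟩

/-- The substitution yields an interval of length `ω T`, covered by `⌈ω⌉` periods; the factor 2
comes from `⌈ω⌉ ≤ ω + 1 ≤ 2 ω`. -/
theorem integral_comp_mul_sub_le_of_periodic {k : ℝ → ℝ} {T : ℝ} (hk : Measurable k)
    (hb : ∀ x, |k x| ≤ 1) (hT : 0 < T)
    (h0 : ∀ x, 0 ≤ k x) (hper : Function.Periodic k T) {ω : ℝ} (hω : 1 ≤ ω) (α : ℝ) :
    ∫ θ in (0 : ℝ)..T, k (ω * θ - α) ≤ 2 * ∫ y in (0 : ℝ)..T, k y := by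
  have hω0 : 0 < ω := by linarith
  rw [intervalIntegral.integral_comp_mul_sub _ hω0.ne']
  have hN : ω ≤ (⌈ω⌉₊ : ℝ) := Nat.le_ceil ω
  have hN2 : (⌈ω⌉₊ : ℝ) < ω + 1 := Nat.ceil_lt_add_one hω0.le
  have hZ : 0 ≤ ∫ y in (0 : ℝ)..T, k y :=
    intervalIntegral.integral_nonneg hT.le fun x _ => h0 x
  have h1 : ∫ x in (ω * 0 - α)..(ω * T - α), k x ≤
      ∫ x in (-α)..(-α + (⌈ω⌉₊ : ℤ) • T), k x := by
    have hle : ω * T ≤ (⌈ω⌉₊ : ℝ) * T := by gcongr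
    refine intervalIntegral.integral_mono_interval (by simp) ?_ ?_
      (Eventually.of_forall h0) (intervalIntegrable_of_abs_le_one hk hb _ _)
    · have : 0 ≤ ω * T := by positivity
      linarith
    · simp only [zsmul_eq_mul, Int.cast_natCast]
      linarith
  rw [hper.intervalIntegral_add_zsmul_eq _ _ (intervalIntegrable_of_abs_le_one hk hb), hper.intervalIntegral_add_eq (-α) 0, zero_add] at h1
  simp only [zsmul_eq_mul, Int.cast_natCast, smul_eq_mul] at h1 ⊢
  calc _ ≤ ω⁻¹ * ((⌈ω⌉₊ : ℝ) * ∫ y in (0 : ℝ)..T, k y) := by gcongr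
    _ ≤ ω⁻¹ * ((2 * ω) * ∫ y in (0 : ℝ)..T, k y) := by gcongr; linarith
    _ = _ := by field_simp

/-- The sets where `cos (ω θ - α)` is bounded away from zero and positive, or negative, each
carry nearly half of the mass of `sin θ dθ` when `ω` is large. -/
theorem exists_le_integral_sin_mul_indicator {η : ℝ} (hη : 0 < η) :
    ∃ ε δ W : ℝ, 0 < ε ∧ ε < Real.pi / 2 ∧ 0 < δ ∧ ∀ ω α : ℝ, W ≤ ω →
      1 - η ≤ (∫ θ in ε..(Real.pi - ε),
        Real.sin θ * {y : ℝ | δ < Real.cos y}.indicator (fun _ => (1 : ℝ)) (ω * θ - α)) ∧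
      1 - η ≤ ∫ θ in ε..(Real.pi - ε),
        Real.sin θ * {y : ℝ | Real.cos y < -δ}.indicator (fun _ => (1 : ℝ)) (ω * θ - α) := by
  have hπ := Real.pi_pos
  obtain ⟨δ, hδ, hZ⟩ := exists_integral_indicator_abs_cos_le_lt (η := η / 3) (by positivity)
  obtain ⟨ε, hε1, hε, hε2⟩ : ∃ ε : ℝ, 1 - η / 3 < Real.cos ε ∧ 0 < ε ∧ ε < Real.pi / 2 := by
    have h1 : ∀ᶠ x in 𝓝[>] (0 : ℝ), 1 - η / 3 < Real.cos x := by
      refine (Real.continuous_cos.tendsto 0).mono_left nhdsWithin_le_nhds |>.eventually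
        (lt_mem_nhds ?_)
      rw [Real.cos_zero]; linarith
    have h2 : ∀ᶠ x in 𝓝[>] (0 : ℝ), x ∈ Set.Ioo 0 (Real.pi / 2) :=
      Ioo_mem_nhdsGT (by positivity)
    obtain ⟨ε, h3, h4⟩ := (h1.and h2).exists
    exact ⟨ε, h3, h4.1, h4.2⟩
  -- Error budget: the polar caps, the set `Z` of small cosine, and the difference between the
  -- masses of `S` and `S'` each cost at most `2 η / 3`. The masses of `S` and `S'` then add up to
  -- at least `2 - 4 η / 3`, so the smaller is at least `1 - η`.
  refine ⟨ε, δ, max 1 ((Real.pi + 2) * Real.pi / (2 * η / 3)), hε, hε2, hδ, fun ω α hω => ?_⟩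
  have hω1 : 1 ≤ ω := (le_max_left _ _).trans hω
  have hω0 : 0 < ω := by linarith
  have hω2 : (Real.pi + 2) * (Real.pi / ω) ≤ 2 * η / 3 := by
    have := (le_max_right _ _).trans hω
    rw [div_le_iff₀ (by positivity)] at this
    rw [← mul_div_assoc, div_le_iff₀ hω0]
    linarith
  set S := {y : ℝ | δ < Real.cos y} with hS
  set S' := {y : ℝ | Real.cos y < -δ} with hS'
  set Z := {y : ℝ | |Real.cos y| ≤ δ} with hZdef
  have mS : MeasurableSet S := measurableSet_lt measurable_const (by fun_prop)
  have mS' : MeasurableSet S' := measurableSet_lt (by fun_prop) measurable_const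
  have mZ : MeasurableSet Z := measurableSet_le (by fun_prop) measurable_const
  have hone : ∀ (A : Set ℝ) x, |A.indicator (fun _ => (1 : ℝ)) x| ≤ 1 := fun A x => by
    by_cases hx : x ∈ A <;> simp [hx]
  have hnn : ∀ (A : Set ℝ) x, 0 ≤ A.indicator (fun _ => (1 : ℝ)) x := fun A x =>
    Set.indicator_nonneg (fun _ _ => zero_le_one) x
  have hm : ∀ A : Set ℝ, MeasurableSet A →
      Measurable fun θ => A.indicator (fun _ => (1 : ℝ)) (ω * θ - α) := fun A hA =>
    (measurable_const.indicator hA).comp (by fun_prop)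
  have hi : ∀ A : Set ℝ, MeasurableSet A → ∀ c d, IntervalIntegrable
      (fun θ => Real.sin θ * A.indicator (fun _ => (1 : ℝ)) (ω * θ - α)) volume c d :=
    fun A hA c d => intervalIntegrable_of_abs_le_one (Real.measurable_sin.mul (hm A hA))
      (fun x => by
        rw [Pi.mul_apply, abs_mul]
        exact mul_le_one₀ (Real.abs_sin_le_one _) (abs_nonneg _) (hone _ _)) c d
  have hshift : ∀ θ : ℝ, S'.indicator (fun _ => (1 : ℝ)) (ω * θ - α) =
      S.indicator (fun _ => (1 : ℝ)) (ω * (θ + Real.pi / ω) - α) := by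
    intro θ
    have : ω * (θ + Real.pi / ω) - α = ω * θ - α + Real.pi := by field_simp; ring
    rw [this]
    simp only [Set.indicator_apply, hS, hS', Set.mem_ofPred_eq, Real.cos_add_pi]
    simp only [lt_neg]
  have hsh := abs_integral_sin_mul_shift_sub_le (hm S mS) (fun x => hone S _) (a := ε)
    (b := Real.pi - ε) (h := Real.pi / ω) (by linarith) (by positivity)
  simp only [← hshift] at hsh
  have hsh2 := hsh.trans (show _ ≤ 2 * η / 3 by
    refine le_trans ?_ hω2
    gcongr
    linarith)
  have hsum : (∫ θ in ε..(Real.pi - ε), Real.sin θ * S.indicator (fun _ => (1 : ℝ)) (ω * θ - α)) +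
      (∫ θ in ε..(Real.pi - ε), Real.sin θ * S'.indicator (fun _ => (1 : ℝ)) (ω * θ - α)) +
      (∫ θ in ε..(Real.pi - ε), Real.sin θ * Z.indicator (fun _ => (1 : ℝ)) (ω * θ - α)) =
      2 * Real.cos ε := by
    rw [← intervalIntegral.integral_add (hi S mS _ _) (hi S' mS' _ _),
      ← intervalIntegral.integral_add ((hi S mS _ _).add (hi S' mS' _ _)) (hi Z mZ _ _)]
    have : ∀ θ : ℝ, Real.sin θ * S.indicator (fun _ => (1 : ℝ)) (ω * θ - α) +
        Real.sin θ * S'.indicator (fun _ => (1 : ℝ)) (ω * θ - α) +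
        Real.sin θ * Z.indicator (fun _ => (1 : ℝ)) (ω * θ - α) = Real.sin θ := by
      intro θ
      simp only [Set.indicator_apply, hS, hS', hZdef, Set.mem_ofPred_eq, abs_le]
      split_ifs <;> grind
    simp only [this, integral_sin, Real.cos_pi_sub]
    ring
  have hZ2 : (∫ θ in ε..(Real.pi - ε), Real.sin θ * Z.indicator (fun _ => (1 : ℝ)) (ω * θ - α)) ≤
      2 * (η / 3) := by
    have hperiodic : Function.Periodic (Z.indicator (fun _ => (1 : ℝ))) Real.pi := by
      intro y
      simp only [Set.indicator_apply, hZdef, Set.mem_ofPred_eq, Real.cos_add_pi, abs_neg]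
    have hii : ∀ c d, IntervalIntegrable
        (fun θ => Z.indicator (fun _ => (1 : ℝ)) (ω * θ - α)) volume c d :=
      intervalIntegrable_of_abs_le_one (hm Z mZ) (fun x => hone _ _)
    calc _ ≤ ∫ θ in ε..(Real.pi - ε), Z.indicator (fun _ => (1 : ℝ)) (ω * θ - α) :=
          intervalIntegral.integral_mono (by linarith) (hi Z mZ _ _) (hii _ _) fun θ =>
            mul_le_of_le_one_left (hnn _ _) (Real.sin_le_one _)
      _ ≤ ∫ θ in (0 : ℝ)..Real.pi, Z.indicator (fun _ => (1 : ℝ)) (ω * θ - α) :=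
          intervalIntegral.integral_mono_interval hε.le (by linarith) (by linarith)
            (Eventually.of_forall fun θ => hnn _ _) (hii _ _)
      _ ≤ 2 * ∫ y in (0 : ℝ)..Real.pi, Z.indicator (fun _ => (1 : ℝ)) y :=
          integral_comp_mul_sub_le_of_periodic (measurable_const.indicator mZ) (hone Z) hπ (hnn Z)
            hperiodic hω1 α
      _ ≤ _ := by gcongr
  rw [abs_le] at hsh2
  constructor <;> linarith [hsh2.1, hsh2.2]

/-- The mass of the sets of polar angles at which the Legendre polynomials of high degree are
positive, or negative, is asymptotically at least one half of the total mass. -/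
theorem eventually_le_setIntegral_sin_legendre {η : ℝ} (hη : 0 < η) :
    ∀ᶠ n : ℕ in atTop,
      1 - η ≤ (∫ θ in {θ | 0 < (legendre n).eval (Real.cos θ)} ∩ Set.Ioo 0 Real.pi, Real.sin θ) ∧
      1 - η ≤ ∫ θ in {θ | (legendre n).eval (Real.cos θ) < 0} ∩ Set.Ioo 0 Real.pi,
        Real.sin θ := by
  obtain ⟨ε, δ, W, hε, hε2, hδ, h⟩ := exists_le_integral_sin_mul_indicator hη
  have hW : ∀ᶠ n : ℕ in atTop, W ≤ (n : ℝ) + 1 / 2 :=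
    (tendsto_atTop_add_const_right _ _ tendsto_natCast_atTop_atTop).eventually_ge_atTop W
  filter_upwards [eventually_sign_legendre hε hε2 hδ, hW] with n ⟨α, hα⟩ hn
  have key : ∀ A B : Set ℝ, MeasurableSet A → MeasurableSet B →
      (∀ θ ∈ Set.Icc ε (Real.pi - ε), ((n : ℝ) + 1 / 2) * θ - α ∈ A → θ ∈ B) →
      (∫ θ in ε..(Real.pi - ε), Real.sin θ *
        A.indicator (fun _ => (1 : ℝ)) (((n : ℝ) + 1 / 2) * θ - α)) ≤
      ∫ θ in B ∩ Set.Ioo 0 Real.pi, Real.sin θ := by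
    intro A B mA mB hAB
    set A' : Set ℝ := (fun θ => ((n : ℝ) + 1 / 2) * θ - α) ⁻¹' A with hA'
    have mA' : MeasurableSet A' := (by fun_prop : Measurable _) mA
    have e : ∀ θ : ℝ, Real.sin θ *
        A.indicator (fun _ => (1 : ℝ)) (((n : ℝ) + 1 / 2) * θ - α) =
        A'.indicator Real.sin θ := by
      intro θ
      by_cases hθ : θ ∈ A'
      · rw [Set.indicator_of_mem hθ, Set.indicator_of_mem (show _ ∈ A from hθ), mul_one]
      · rw [Set.indicator_of_notMem hθ, Set.indicator_of_notMem (show _ ∉ A from hθ), mul_zero]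
    simp only [e]
    rw [intervalIntegral.integral_of_le (by linarith), setIntegral_indicator mA']
    refine setIntegral_mono_set ?_ ?_ (LE.le.eventuallyLE ?_)
    · exact (Real.continuous_sin.integrableOn_Icc (a := 0) (b := Real.pi)).mono_set
        (Set.inter_subset_right.trans Set.Ioo_subset_Icc_self)
    · refine (ae_restrict_mem (mB.inter measurableSet_Ioo)).mono fun θ hθ => ?_
      exact (Real.sin_pos_of_mem_Ioo hθ.2).le
    · rintro θ ⟨h1, h2⟩
      exact ⟨hAB θ ⟨h1.1.le, h1.2⟩ h2, by linarith [h1.1], by linarith [h1.2]⟩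
  have mP : Measurable fun θ : ℝ => (legendre n).eval (Real.cos θ) :=
    ((legendre n).continuous.comp Real.continuous_cos).measurable
  refine ⟨(h _ α hn).1.trans (key _ _ ?_ ?_ fun θ hθ => (hα θ hθ).1),
    (h _ α hn).2.trans (key _ _ ?_ ?_ fun θ hθ => (hα θ hθ).2)⟩
  · exact measurableSet_lt measurable_const (by fun_prop)
  · exact measurableSet_lt measurable_const mP
  · exact measurableSet_lt (by fun_prop) measurable_const
  · exact measurableSet_lt mP measurable_const

/-! ### Area of rotation-invariant subsets of the sphere. -/

theorem measurePreserving_coords :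
    MeasurePreserving (fun y : E3 => (y 2, (y 0, y 1))) volume volume := by
  have h1 := PiLp.volume_preserving_ofLp (Fin 3)
  have h2 := volume_preserving_piFinSuccAbove (fun _ : Fin 3 => ℝ) 2
  have h3 := (MeasurePreserving.id (volume : Measure ℝ)).prod (volume_preserving_finTwoArrow ℝ)
  exact (h3.comp h2).comp h1

/-- Cylindrical coordinates for functions that are invariant under rotations about the axis. -/
theorem lintegral_cylindrical {F : ℝ × ℝ → ENNReal} (hF : Measurable F) :
    ∫⁻ y : E3, F (y 2, √(y 0 ^ 2 + y 1 ^ 2)) =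
      ENNReal.ofReal (2 * Real.pi) *
        ∫⁻ p : ℝ × ℝ, {p : ℝ × ℝ | 0 < p.2}.indicator (fun p => ENNReal.ofReal p.2 * F p) p := by
  have hm : Measurable fun p : ℝ × (ℝ × ℝ) => F (p.1, √(p.2.1 ^ 2 + p.2.2 ^ 2)) :=
    hF.comp (by fun_prop)
  rw [measurePreserving_coords.lintegral_comp hm, Measure.volume_eq_prod,
    lintegral_prod _ hm.aemeasurable]
  have hset : MeasurableSet {p : ℝ × ℝ | 0 < p.2} :=
    measurableSet_lt measurable_const measurable_snd
  have hG : Measurable fun p : ℝ × ℝ =>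
      {p : ℝ × ℝ | 0 < p.2}.indicator (fun p => ENNReal.ofReal p.2 * F p) p :=
    Measurable.indicator (by fun_prop) hset
  rw [Measure.volume_eq_prod ℝ ℝ, lintegral_prod _ hG.aemeasurable, ← lintegral_const_mul]
  swap
  · exact hG.lintegral_prod_right'
  refine lintegral_congr fun z => ?_
  have hz : Measurable fun ρ : ℝ => F (z, ρ) := hF.comp (by fun_prop)
  rw [← Measure.volume_eq_prod, ← lintegral_comp_polarCoord_symm]
  have h1 : ∀ p ∈ polarCoord.target, ENNReal.ofReal p.1 • F (z,
      √((polarCoord.symm p).1 ^ 2 + (polarCoord.symm p).2 ^ 2)) =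
      ENNReal.ofReal p.1 * F (z, p.1) := by
    rintro ⟨r, φ⟩ ⟨hr, -⟩
    have : (r * Real.cos φ) ^ 2 + (r * Real.sin φ) ^ 2 = r ^ 2 := by
      linear_combination r ^ 2 * Real.sin_sq_add_cos_sq φ
    simp only [polarCoord_symm_apply, smul_eq_mul, this, Real.sqrt_sq (le_of_lt hr)]
  rw [setLIntegral_congr_fun polarCoord.open_target.measurableSet h1, polarCoord_target,
    Measure.volume_eq_prod, setLIntegral_prod]
  swap
  · exact Measurable.aemeasurable (by fun_prop)
  have h2 : ∀ ρ : ℝ, {p : ℝ × ℝ | 0 < p.2}.indicator (fun p => ENNReal.ofReal p.2 * F p) (z, ρ) =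
      (Set.Ioi 0).indicator (fun ρ => ENNReal.ofReal ρ * F (z, ρ)) ρ := fun ρ => rfl
  simp only [h2]
  rw [lintegral_indicator measurableSet_Ioi, ← lintegral_const_mul _ (by fun_prop)]
  refine lintegral_congr fun ρ => ?_
  rw [setLIntegral_const, Real.volume_Ioo, mul_comm]
  congr 2
  ring

/-- Spherical coordinates for functions that are invariant under rotations about the axis. -/
theorem lintegral_spherical {F : ℝ × ℝ → ENNReal} (hF : Measurable F) :
    ∫⁻ y : E3, F (y 2, √(y 0 ^ 2 + y 1 ^ 2)) =
      ENNReal.ofReal (2 * Real.pi) * ∫⁻ r in Set.Ioi (0 : ℝ), ∫⁻ θ in Set.Ioo 0 Real.pi,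
        ENNReal.ofReal (r ^ 2) * (ENNReal.ofReal (Real.sin θ) *
          F (r * Real.cos θ, r * Real.sin θ)) := by
  -- Polar coordinates again, now in the half plane of height and distance to the axis. The
  -- condition of positive distance cuts the angles `(-π, π)` down to `(0, π)`, and the two
  -- Jacobians multiply to `r ^ 2 * sin θ`.
  rw [lintegral_cylindrical hF, ← lintegral_comp_polarCoord_symm]
  congr 1
  have h1 : ∀ p ∈ polarCoord.target, ENNReal.ofReal p.1 •
      {p : ℝ × ℝ | 0 < p.2}.indicator (fun p => ENNReal.ofReal p.2 * F p) (polarCoord.symm p) =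
      (Set.univ ×ˢ Set.Ioo 0 Real.pi).indicator (fun p : ℝ × ℝ =>
        ENNReal.ofReal (p.1 ^ 2) * (ENNReal.ofReal (Real.sin p.2) *
          F (p.1 * Real.cos p.2, p.1 * Real.sin p.2))) p := by
    rintro ⟨r, θ⟩ ⟨hr, hθ⟩
    simp only [Set.mem_Ioi, Set.mem_Ioo] at hr hθ
    by_cases h : 0 < θ
    · have hs := Real.sin_pos_of_pos_of_lt_pi h hθ.2
      rw [Set.indicator_of_mem (by simp only [polarCoord_symm_apply]; exact mul_pos hr hs),
        Set.indicator_of_mem (by simp [h, hθ.2])]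
      simp only [polarCoord_symm_apply, smul_eq_mul]
      rw [ENNReal.ofReal_mul hr.le, sq, ENNReal.ofReal_mul hr.le]
      ring
    · have hs : Real.sin θ ≤ 0 := Real.sin_nonpos_of_nonpos_of_neg_pi_le (not_lt.1 h) hθ.1.le
      rw [Set.indicator_of_notMem, Set.indicator_of_notMem (by simp [h]), smul_zero]
      simp only [polarCoord_symm_apply, Set.mem_ofPred_eq, not_lt]
      exact mul_nonpos_of_nonneg_of_nonpos hr.le hs
  have hG : Measurable fun p : ℝ × ℝ => ENNReal.ofReal (p.1 ^ 2) *
      (ENNReal.ofReal (Real.sin p.2) * F (p.1 * Real.cos p.2, p.1 * Real.sin p.2)) := by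
    fun_prop
  rw [setLIntegral_congr_fun polarCoord.open_target.measurableSet h1,
    setLIntegral_indicator (MeasurableSet.univ.prod measurableSet_Ioo), polarCoord_target,
    Set.prod_inter_prod, Set.univ_inter,
    Set.inter_eq_left.2 (Set.Ioo_subset_Ioo_left (by linarith [Real.pi_pos])),
    Measure.volume_eq_prod, setLIntegral_prod _ hG.aemeasurable]

theorem measurable_polar : Measurable polar := by
  unfold polar
  have : Measurable fun x : S2 => (x : E3) 2 := by fun_prop
  exact Real.continuous_arccos.measurable.comp this

-- `Measure.toSphere` is the dimension times the volume of the cone over a set; here that cone is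
-- described by the norm and the axis coordinate.
open scoped Pointwise in
theorem smul_image_polar_preimage (A : Set ℝ) :
    Set.Ioo (0 : ℝ) 1 • ((↑) '' (polar ⁻¹' A) : Set E3) =
      {y : E3 | (0 < ‖y‖ ∧ ‖y‖ < 1) ∧ Real.arccos (y 2 / ‖y‖) ∈ A} := by
  ext y
  rw [Set.mem_smul]
  constructor
  · rintro ⟨r, ⟨hr0, hr1⟩, _, ⟨x, hx, rfl⟩, rfl⟩
    have hn : ‖r • (x : E3)‖ = r := by
      rw [norm_smul, norm_eq_of_mem_sphere x, mul_one, Real.norm_of_nonneg hr0.le]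
    simp only [Set.mem_ofPred_eq, hn]
    refine ⟨⟨hr0, hr1⟩, ?_⟩
    simpa [hr0.ne'] using! hx
  · rintro ⟨⟨h0, h1⟩, h2⟩
    refine ⟨‖y‖, ⟨h0, h1⟩, ‖y‖⁻¹ • y, ⟨⟨‖y‖⁻¹ • y, by simp [norm_smul, h0.ne']⟩, ?_, rfl⟩, ?_⟩
    · simp only [Set.mem_preimage, polar, PiLp.smul_apply, smul_eq_mul]
      rwa [mul_comm, ← div_eq_mul_inv]
    · simp [smul_smul, h0.ne']

theorem lintegral_Ioo_ofReal_sq : ∫⁻ r in Set.Ioo (0 : ℝ) 1, ENNReal.ofReal (r ^ 2) =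
    ENNReal.ofReal (1 / 3) := by
  rw [Measure.restrict_congr_set Ioo_ae_eq_Ioc, ← ofReal_integral_eq_lintegral_ofReal,
    ← intervalIntegral.integral_of_le zero_le_one]
  · rw [integral_pow]; norm_num
  · exact ((continuous_pow 2).integrableOn_Icc).mono_set Set.Ioc_subset_Icc_self
  · exact Eventually.of_forall fun r => sq_nonneg r

/-- The area of a set of the sphere that is invariant under rotations about the axis. -/
theorem area_polar_preimage {A : Set ℝ} (hA : MeasurableSet A) :
    area (polar ⁻¹' A) = ENNReal.ofReal (2 * Real.pi) *
      ∫⁻ θ in A ∩ Set.Ioo 0 Real.pi, ENNReal.ofReal (Real.sin θ) := by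
  rw [area, Measure.toSphere_apply' _ (measurable_polar hA), smul_image_polar_preimage]
  set B : Set (ℝ × ℝ) := {p | (0 < √(p.1 ^ 2 + p.2 ^ 2) ∧ √(p.1 ^ 2 + p.2 ^ 2) < 1) ∧
    Real.arccos (p.1 / √(p.1 ^ 2 + p.2 ^ 2)) ∈ A} with hB
  have mB : MeasurableSet B := by
    have hr : Measurable fun p : ℝ × ℝ => √(p.1 ^ 2 + p.2 ^ 2) := by fun_prop
    refine (MeasurableSet.inter (measurableSet_lt measurable_const hr)
      (measurableSet_lt hr measurable_const)).inter ?_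
    have : Measurable fun p : ℝ × ℝ => Real.arccos (p.1 / √(p.1 ^ 2 + p.2 ^ 2)) :=
      Real.continuous_arccos.measurable.comp (by fun_prop)
    exact this hA
  have hn : ∀ y : E3, ‖y‖ = √(y 2 ^ 2 + √(y 0 ^ 2 + y 1 ^ 2) ^ 2) := by
    intro y
    rw [EuclideanSpace.norm_eq, Fin.sum_univ_three, Real.sq_sqrt (by positivity)]
    simp only [Real.norm_eq_abs, sq_abs]
    congr 1
    ring
  have hset : {y : E3 | (0 < ‖y‖ ∧ ‖y‖ < 1) ∧ Real.arccos (y 2 / ‖y‖) ∈ A} =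
      (fun y : E3 => (y 2, √(y 0 ^ 2 + y 1 ^ 2))) ⁻¹' B := by
    ext y
    simp only [hB, Set.mem_preimage, Set.mem_ofPred_eq, ← hn]
  have hmeas : MeasurableSet ((fun y : E3 => (y 2, √(y 0 ^ 2 + y 1 ^ 2))) ⁻¹' B) :=
    (by fun_prop : Measurable fun y : E3 => (y 2, √(y 0 ^ 2 + y 1 ^ 2))) mB
  rw [hset, ← lintegral_indicator_one hmeas]
  have hcomp : (fun y : E3 => ((fun y : E3 => (y 2, √(y 0 ^ 2 + y 1 ^ 2))) ⁻¹' B).indicator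
      (1 : E3 → ENNReal) y) = fun y : E3 => B.indicator (1 : ℝ × ℝ → ENNReal)
        (y 2, √(y 0 ^ 2 + y 1 ^ 2)) := by
    funext y
    rfl
  rw [hcomp, lintegral_spherical (measurable_one.indicator mB)]
  have hinner : ∀ r ∈ Set.Ioi (0 : ℝ), (∫⁻ θ in Set.Ioo 0 Real.pi,
      ENNReal.ofReal (r ^ 2) * (ENNReal.ofReal (Real.sin θ) *
        B.indicator (1 : ℝ × ℝ → ENNReal) (r * Real.cos θ, r * Real.sin θ))) =
      (Set.Iio 1).indicator (fun r => ENNReal.ofReal (r ^ 2) *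
        ∫⁻ θ in A ∩ Set.Ioo 0 Real.pi, ENNReal.ofReal (Real.sin θ)) r := by
    intro r hr
    have hr0 : 0 < r := hr
    have hmem : ∀ θ ∈ Set.Ioo 0 Real.pi,
        ((r * Real.cos θ, r * Real.sin θ) ∈ B ↔ r < 1 ∧ θ ∈ A) := by
      intro θ hθ
      have : (r * Real.cos θ) ^ 2 + (r * Real.sin θ) ^ 2 = r ^ 2 := by
        linear_combination r ^ 2 * Real.sin_sq_add_cos_sq θ
      simp only [hB, Set.mem_ofPred_eq, this, Real.sqrt_sq hr0.le, mul_div_cancel_left₀ _ hr0.ne',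
        Real.arccos_cos hθ.1.le hθ.2.le, hr0, true_and]
    rw [lintegral_const_mul' _ _ ENNReal.ofReal_ne_top]
    by_cases h1 : r < 1
    · rw [Set.indicator_of_mem (by exact h1), ← setLIntegral_indicator hA]
      congr 1
      refine setLIntegral_congr_fun measurableSet_Ioo fun θ hθ => ?_
      by_cases hθA : θ ∈ A
      · simp only [Set.indicator_of_mem ((hmem θ hθ).2 ⟨h1, hθA⟩), Set.indicator_of_mem hθA,
          Pi.one_apply, mul_one]
      · simp only [Set.indicator_of_notMem (fun h => hθA ((hmem θ hθ).1 h).2),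
          Set.indicator_of_notMem hθA, mul_zero]
    · rw [Set.indicator_of_notMem (by exact h1)]
      rw [setLIntegral_congr_fun (g := fun _ => 0) measurableSet_Ioo fun θ hθ => ?_]
      · simp
      · simp only [Set.indicator_of_notMem (fun h => h1 ((hmem θ hθ).1 h).1), mul_zero]
  rw [setLIntegral_congr_fun measurableSet_Ioi hinner, setLIntegral_indicator measurableSet_Iio,
    Set.inter_comm, Set.Ioi_inter_Iio, lintegral_mul_const _ (by fun_prop),
    lintegral_Ioo_ofReal_sq]
  -- The dimension factor 3 of `Measure.toSphere` cancels the radial integral `1 / 3`.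
  rw [mul_left_comm, ← mul_assoc ((Module.finrank ℝ E3 : ℕ) : ENNReal)]
  have : ((Module.finrank ℝ E3 : ℕ) : ENNReal) * ENNReal.ofReal (1 / 3) = 1 := by
    rw [finrank_euclideanSpace_fin, ← ENNReal.ofReal_natCast, ← ENNReal.ofReal_mul (by positivity)]
    norm_num
  rw [this, one_mul]

theorem area_real_polar_preimage {A : Set ℝ} (hA : MeasurableSet A) :
    area.real (polar ⁻¹' A) = 2 * Real.pi * ∫ θ in A ∩ Set.Ioo 0 Real.pi, Real.sin θ := by
  rw [measureReal_def, area_polar_preimage hA, ENNReal.toReal_mul,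
    ENNReal.toReal_ofReal (by positivity), integral_eq_lintegral_of_nonneg_ae]
  · exact (ae_restrict_mem (hA.inter measurableSet_Ioo)).mono fun θ hθ =>
      (Real.sin_pos_of_mem_Ioo hθ.2).le
  · exact Real.continuous_sin.aestronglyMeasurable

/-! ### Isometries of the sphere and the non-zonal harmonics. -/

/-- The action of a linear isometry of space on the sphere. -/
noncomputable def sphereMap (R : E3 ≃ₗᵢ[ℝ] E3) (x : S2) : S2 := ⟨R x, by simp⟩

theorem continuous_sphereMap (R : E3 ≃ₗᵢ[ℝ] E3) : Continuous (sphereMap R) :=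
  (R.continuous.comp continuous_subtype_val).subtype_mk _

-- The cone over a preimage is the preimage of the cone, and linear isometries preserve volume.
open scoped Pointwise in
theorem measurePreserving_sphereMap (R : E3 ≃ₗᵢ[ℝ] E3) :
    MeasurePreserving (sphereMap R) area area := by
  refine ⟨(continuous_sphereMap R).measurable, Measure.ext fun s hs => ?_⟩
  have hs' : MeasurableSet (sphereMap R ⁻¹' s) := (continuous_sphereMap R).measurable hs
  rw [Measure.map_apply (continuous_sphereMap R).measurable hs, area,
    Measure.toSphere_apply' _ hs', Measure.toSphere_apply' _ hs]
  have : Set.Ioo (0 : ℝ) 1 • ((↑) '' (sphereMap R ⁻¹' s) : Set E3) =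
      R.toMeasurableEquiv ⁻¹' (Set.Ioo (0 : ℝ) 1 • ((↑) '' s : Set E3)) := by
    ext y
    simp only [Set.mem_smul, Set.mem_preimage]
    constructor
    · rintro ⟨r, hr, _, ⟨x, hx, rfl⟩, rfl⟩
      exact ⟨r, hr, _, ⟨_, hx, rfl⟩, (map_smul R r (x : E3)).symm⟩
    · rintro ⟨r, hr, _, ⟨x, hx, rfl⟩, h⟩
      refine ⟨r, hr, R.symm x, ⟨⟨R.symm x, by simp⟩, ?_, rfl⟩, ?_⟩
      · have : sphereMap R ⟨R.symm x, by simp⟩ = x := by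
          ext1
          simp [sphereMap]
        rwa [Set.mem_preimage, this]
      · apply R.injective
        rw [map_smul, R.apply_symm_apply]
        exact h
  have hR : MeasurePreserving R.toMeasurableEquiv volume volume := R.measurePreserving
  rw [this, hR.measure_preimage_equiv]

/-- If an isometry of the sphere changes the sign of a function, then this function is positive and
negative on sets of the same nonzero area. -/
theorem area_ratio_eq_one_of_comp_sphereMap_eq_neg {f : S2 → ℝ} (hf : Continuous f) (hf0 : f ≠ 0)
    (R : E3 ≃ₗᵢ[ℝ] E3) (hR : ∀ x, f (sphereMap R x) = -f x) :
    area.real {x | 0 < f x} / area.real {x | f x < 0} = 1 := by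
  have mneg : MeasurableSet {x | f x < 0} := measurableSet_lt hf.measurable measurable_const
  have heq : area {x | 0 < f x} = area {x | f x < 0} := by
    rw [← (measurePreserving_sphereMap R).measure_preimage mneg.nullMeasurableSet]
    congr 1
    ext x
    simp [hR]
  rw [measureReal_def, measureReal_def, heq, div_self]
  have hfin : area {x | f x < 0} ≠ ⊤ := measure_ne_top (volume : Measure E3).toSphere _
  -- The area charges every nonempty open set, so if one sign set were null, both would be empty and
  -- `f` would vanish.
  refine (ENNReal.toReal_pos (fun h0 => hf0 ?_) hfin).ne'
  have h1 : {x | f x < 0} = ∅ :=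
    ((isOpen_lt hf continuous_const).measure_eq_zero_iff (volume : Measure E3).toSphere).1 h0
  have h2 : {x | 0 < f x} = ∅ :=
    ((isOpen_lt continuous_const hf).measure_eq_zero_iff (volume : Measure E3).toSphere).1
      (heq.trans h0)
  funext x
  have h3 : x ∉ {x | f x < 0} := by rw [h1]; exact Set.notMem_empty x
  have h4 : x ∉ {x | 0 < f x} := by rw [h2]; exact Set.notMem_empty x
  exact le_antisymm (not_lt.1 h4) (not_lt.1 h3)

/-- The linear map underlying `axisRotation`. -/
noncomputable def axisRotationLinear (β : ℝ) : E3 →ₗ[ℝ] E3 where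
  toFun y := !₂[Real.cos β * y 0 - Real.sin β * y 1, Real.sin β * y 0 + Real.cos β * y 1, y 2]
  map_add' y z := by
    ext i
    fin_cases i <;> simp <;> ring
  map_smul' c y := by
    ext i
    fin_cases i <;> simp <;> ring

/-- The rotation by the angle `β` about the third axis. -/
noncomputable def axisRotation (β : ℝ) : E3 ≃ₗᵢ[ℝ] E3 :=
  LinearIsometry.toLinearIsometryEquiv
    { toLinearMap := axisRotationLinear β
      norm_map' := fun y => by
        rw [EuclideanSpace.norm_eq, EuclideanSpace.norm_eq, Fin.sum_univ_three, Fin.sum_univ_three]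
        simp only [Real.norm_eq_abs, sq_abs]
        congr 1
        simp only [axisRotationLinear, LinearMap.coe_mk, AddHom.coe_mk, PiLp.toLp_apply,
          Matrix.cons_val_zero, Matrix.cons_val_one, Matrix.cons_val]
        linear_combination (y 0 ^ 2 + y 1 ^ 2) * Real.sin_sq_add_cos_sq β } rfl

/-- The point of the equatorial plane below a point of the sphere, as a complex number. -/
noncomputable def planar (x : S2) : ℂ := ⟨(x : E3) 0, (x : E3) 1⟩

theorem planar_sphereMap_axisRotation (β : ℝ) (x : S2) :
    planar (sphereMap (axisRotation β) x) = Complex.exp (β * Complex.I) * planar x := by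
  apply Complex.ext
  · rw [Complex.mul_re, Complex.exp_ofReal_mul_I_re, Complex.exp_ofReal_mul_I_im]
    rfl
  · rw [Complex.mul_im, Complex.exp_ofReal_mul_I_re, Complex.exp_ofReal_mul_I_im, add_comm]
    rfl

theorem sphereMap_axisRotation_two (β : ℝ) (x : S2) :
    (sphereMap (axisRotation β) x : E3) 2 = (x : E3) 2 := rfl

theorem sum_sq_coords (x : S2) :
    (x : E3) 0 ^ 2 + (x : E3) 1 ^ 2 + (x : E3) 2 ^ 2 = 1 := by
  have h := norm_eq_of_mem_sphere x
  rw [EuclideanSpace.norm_eq, Fin.sum_univ_three, Real.sqrt_eq_one] at h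
  simpa using h

theorem cos_polar (x : S2) : Real.cos (polar x) = (x : E3) 2 := by
  have h := sum_sq_coords x
  exact Real.cos_arccos (by nlinarith [sq_nonneg ((x : E3) 0), sq_nonneg ((x : E3) 1)])
    (by nlinarith [sq_nonneg ((x : E3) 0), sq_nonneg ((x : E3) 1)])

theorem sqrt_one_sub_sq_eq_norm_planar (x : S2) : √(1 - (x : E3) 2 ^ 2) = ‖planar x‖ := by
  rw [Complex.norm_def]
  congr 1
  rw [planar, Complex.normSq_mk]
  linear_combination -sum_sq_coords x

theorem planar_pow (m : ℕ) (x : S2) :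
    planar x ^ m = (‖planar x‖ ^ m : ℝ) * Complex.exp ((m * azimuth x : ℝ) * Complex.I) := by
  nth_rewrite 1 [← Complex.norm_mul_exp_arg_mul_I (planar x)]
  rw [mul_pow, ← Complex.exp_nat_mul]
  push_cast
  rw [← mul_assoc]
  rfl

/-- The factor `(1 - t²)^(m/2)` is the `m`-th power of the modulus of `planar x`, so it combines
with the angular factor into a power of `planar x`. This gives continuity despite the jump of
`azimuth`, and makes the effect of rotations visible. -/
theorem cosHarmonic_eq (n m : ℕ) (x : S2) : cosHarmonic n m x =
    (-1) ^ m * (Polynomial.derivative^[m] (legendre n)).eval ((x : E3) 2) *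
      (planar x ^ m).re := by
  rw [planar_pow, Complex.re_ofReal_mul, Complex.exp_ofReal_mul_I_re, cosHarmonic, assocLegendre,
    cos_polar, sqrt_one_sub_sq_eq_norm_planar]
  ring

theorem sinHarmonic_eq (n m : ℕ) (x : S2) : sinHarmonic n m x =
    (-1) ^ m * (Polynomial.derivative^[m] (legendre n)).eval ((x : E3) 2) *
      (planar x ^ m).im := by
  rw [planar_pow, Complex.im_ofReal_mul, Complex.exp_ofReal_mul_I_im, sinHarmonic, assocLegendre,
    cos_polar, sqrt_one_sub_sq_eq_norm_planar]
  ring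

theorem continuous_planar : Continuous planar := by
  have : Continuous fun x : S2 => (((x : E3) 0 : ℝ) : ℂ) + (((x : E3) 1 : ℝ) : ℂ) * Complex.I := by
    fun_prop
  convert! this using 2 with x
  exact Complex.mk_eq_add_mul_I _ _

theorem planar_sphereMap_pow {m : ℕ} (hm : 1 ≤ m) (x : S2) :
    planar (sphereMap (axisRotation (Real.pi / m)) x) ^ m = -planar x ^ m := by
  have hm0 : (m : ℂ) ≠ 0 := by exact_mod_cast (by omega : m ≠ 0)
  rw [planar_sphereMap_axisRotation, mul_pow, ← Complex.exp_nat_mul]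
  have : (m : ℂ) * (((Real.pi / m : ℝ) : ℂ) * Complex.I) = Real.pi * Complex.I := by
    push_cast
    field_simp
  rw [this, Complex.exp_pi_mul_I, neg_one_mul]

theorem area_ratio_cosHarmonic {n m : ℕ} (hm : 1 ≤ m) (h0 : cosHarmonic n m ≠ 0) :
    area.real {x | 0 < cosHarmonic n m x} / area.real {x | cosHarmonic n m x < 0} = 1 := by
  refine area_ratio_eq_one_of_comp_sphereMap_eq_neg ?_ h0 (axisRotation (Real.pi / m)) fun x => ?_
  · rw [funext (cosHarmonic_eq n m)]
    have := continuous_planar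
    have := (Polynomial.derivative^[m] (legendre n)).continuous
    fun_prop
  · rw [cosHarmonic_eq, cosHarmonic_eq, planar_sphereMap_pow hm, sphereMap_axisRotation_two,
      Complex.neg_re, mul_neg]

theorem area_ratio_sinHarmonic {n m : ℕ} (hm : 1 ≤ m) (h0 : sinHarmonic n m ≠ 0) :
    area.real {x | 0 < sinHarmonic n m x} / area.real {x | sinHarmonic n m x < 0} = 1 := by
  refine area_ratio_eq_one_of_comp_sphereMap_eq_neg ?_ h0 (axisRotation (Real.pi / m)) fun x => ?_
  · rw [funext (sinHarmonic_eq n m)]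
    have := continuous_planar
    have := (Polynomial.derivative^[m] (legendre n)).continuous
    fun_prop
  · rw [sinHarmonic_eq, sinHarmonic_eq, planar_sphereMap_pow hm, sphereMap_axisRotation_two,
      Complex.neg_im, mul_neg]

/-! ### Zonal functions and the conclusion. -/

/-- The zonal functions of high degree are positive and negative on sets of asymptotically equal
area. -/
theorem tendsto_area_ratio_zonal :
    Tendsto (fun n : ℕ => area.real {x | 0 < zonal n x} / area.real {x | zonal n x < 0})
      atTop (𝓝 1) := by
  have hπ := Real.pi_pos
  set p : ℕ → ℝ := fun n =>
    ∫ θ in {θ | 0 < (legendre n).eval (Real.cos θ)} ∩ Set.Ioo 0 Real.pi, Real.sin θ with hp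
  set q : ℕ → ℝ := fun n =>
    ∫ θ in {θ | (legendre n).eval (Real.cos θ) < 0} ∩ Set.Ioo 0 Real.pi, Real.sin θ with hq
  have mP : ∀ n, Measurable fun θ : ℝ => (legendre n).eval (Real.cos θ) := fun n =>
    ((legendre n).continuous.comp Real.continuous_cos).measurable
  have mpos : ∀ n, MeasurableSet {θ : ℝ | 0 < (legendre n).eval (Real.cos θ)} := fun n =>
    measurableSet_lt measurable_const (mP n)
  have mneg : ∀ n, MeasurableSet {θ : ℝ | (legendre n).eval (Real.cos θ) < 0} := fun n =>
    measurableSet_lt (mP n) measurable_const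
  have hratio : ∀ n, area.real {x | 0 < zonal n x} / area.real {x | zonal n x < 0} =
      p n / q n := fun n => by
    have h1 := area_real_polar_preimage (mpos n)
    have h2 := area_real_polar_preimage (mneg n)
    exact (congrArg₂ (· / ·) h1 h2).trans (mul_div_mul_left _ _ (by positivity))
  have hsum : ∀ n, p n + q n ≤ 2 := fun n => by
    have hint : IntegrableOn Real.sin (Set.Ioo 0 Real.pi) :=
      (Real.continuous_sin.integrableOn_Icc (a := 0) (b := Real.pi)).mono_set
        Set.Ioo_subset_Icc_self
    rw [hp, hq, ← setIntegral_union _ ((mneg n).inter measurableSet_Ioo)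
      (hint.mono_set Set.inter_subset_right) (hint.mono_set Set.inter_subset_right)]
    · calc _ ≤ ∫ θ in Set.Ioo 0 Real.pi, Real.sin θ := by
            refine setIntegral_mono_set hint ?_ (LE.le.eventuallyLE
              (Set.union_subset Set.inter_subset_right Set.inter_subset_right))
            exact (ae_restrict_mem measurableSet_Ioo).mono fun θ hθ =>
              (Real.sin_pos_of_mem_Ioo hθ).le
        _ = 2 := by
            rw [← integral_Ioc_eq_integral_Ioo, ← intervalIntegral.integral_of_le hπ.le,
              integral_sin]
            norm_num
    · refine Set.disjoint_left.2 fun θ h1 h2 => ?_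
      exact lt_asymm (show 0 < (legendre n).eval (Real.cos θ) from h1.1) h2.1
  -- Only lower bounds are available; the upper bound for each mass comes from the lower bound for
  -- the other and the total 2.
  have hlim : Tendsto p atTop (𝓝 1) ∧ Tendsto q atTop (𝓝 1) := by
    constructor <;>
    · refine Metric.tendsto_nhds.2 fun η hη => ?_
      filter_upwards [eventually_le_setIntegral_sin_legendre (half_pos hη)] with n hn
      have h1 : 1 - η / 2 ≤ p n := hn.1
      have h2 : 1 - η / 2 ≤ q n := hn.2
      rw [Real.dist_eq, abs_lt]
      constructor <;> linarith [hsum n]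
  simp only [hratio]
  simpa only [div_one] using! hlim.1.div hlim.2 one_ne_zero

/-- A function has at most one eigenvalue. -/
theorem IsEigenfunction.eigenvalue_unique {f : S2 → ℝ} {μ ν : ℝ} (hμ : IsEigenfunction f μ)
    (hν : IsEigenfunction f ν) : μ = ν := by
  obtain ⟨x, hx⟩ := Function.ne_iff.1 hμ.2.1
  exact mul_right_cancel₀ hx ((hμ.2.2 x).symm.trans (hν.2.2 x))

/-- A given function occurs only finitely often in a sequence of eigenfunctions whose degrees tend
to infinity. -/
theorem eventually_ne_of_isEigenfunction {ψ : ℕ → S2 → ℝ} {n : ℕ → ℕ}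
    (heigen : ∀ k, IsEigenfunction (ψ k) ((n k : ℝ) * ((n k : ℝ) + 1)))
    (hn : Tendsto n atTop atTop) (f : S2 → ℝ) : ∀ᶠ k in atTop, ψ k ≠ f := by
  by_cases h : ∃ j, ψ j = f
  · obtain ⟨j, rfl⟩ := h
    filter_upwards [hn.eventually_gt_atTop (n j)] with k hk heq
    have h1 := (heigen k).eigenvalue_unique (heq ▸ heigen j)
    have h2 : n k * (n k + 1) = n j * (n j + 1) := by exact_mod_cast h1
    nlinarith
  · exact Eventually.of_forall fun k hk => h ⟨k, hk⟩

end SphericalHarmonics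

theorem theorem3 (ψ : ℕ → SphericalHarmonics.S2 → ℝ) (n : ℕ → ℕ)
    (hbasis : ∀ k, ψ k ∈ SphericalHarmonics.basis)
    (heigen : ∀ k, SphericalHarmonics.IsEigenfunction (ψ k) ((n k : ℝ) * ((n k : ℝ) + 1)))
    (hn : Tendsto n atTop atTop) :
    Tendsto
      (fun k => SphericalHarmonics.area.real {x | 0 < ψ k x} /
        SphericalHarmonics.area.real {x | ψ k x < 0})
      atTop (𝓝 1) := by
  open SphericalHarmonics in
  refine Metric.tendsto_nhds.2 fun η hη => ?_
  obtain ⟨N, hN⟩ := eventually_atTop.1 (Metric.tendsto_nhds.1 tendsto_area_ratio_zonal η hη)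
  -- The finitely many zonal functions of degree below `N` are eventually avoided, so a zonal `ψ k`
  -- has large degree without any comparison of that degree with `n k`.
  have hlow : ∀ᶠ k in atTop, ∀ j ∈ Finset.range N, ψ k ≠ zonal j :=
    (Filter.eventually_all_finset _).2 fun j _ => eventually_ne_of_isEigenfunction heigen hn _
  filter_upwards [hlow] with k hk
  have h0 : ψ k ≠ 0 := (heigen k).2.1
  rcases hbasis k with ⟨j, hj⟩ | ⟨l, m, hm, -, hj | hj⟩
  · have hjN : N ≤ j := by
      by_contra hlt
      exact hk j (Finset.mem_range.2 (not_le.1 hlt)) hj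
    rw [hj]
    exact hN j hjN
  · rw [hj] at h0 ⊢
    rw [area_ratio_cosHarmonic hm h0, dist_self]
    exact hη
  · rw [hj] at h0 ⊢
    rw [area_ratio_sinHarmonic hm h0, dist_self]
    exact hη
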